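/- A \emph{quotient Borel space} is a pair $(X,E)$, with $X$ a standard Borel space and $E$ a countable Borel equivalence relation on $X$; its underlying set is $X/E$. A subset of $X/E$ is Borel if its preimage in $X$ is Borel. A relation $R\subseteq X/E\times Y/F$ between quotient Borel spaces $(X,E)$, $(Y,F)$ is Borel if its preimage in $X\times Y$ is Borel, and a function $X/E\to Y/F$ is Borel if its graph is a Borel relation. A countable Borel equivalence relation $R$ on $(X,E)$ (Borel as a relation, with countable classes) has \emph{index} $n$ if all its classes have exactly $n$ elements; it is \emph{smooth} if it has a Borel transversal, i.e. a Borel set $T\subseteq X/E$ meeting every class in exactly one point; a \emph{Borel selector} for it is a Borel map $\varphi:X/E\to X/E$ with $a\mathrel{R}\varphi(a)$ for all $a$ and $\varphi(a)=\varphi(b)$ whenever $a\mathrel{R}b$; it is \emph{generated} by a map $f$ if it is the smallest equivalence relation containing the graph of $f$; it is \emph{Borel enumerable} if it is the union of the graphs of countably many Borel maps $f_n:X/E\to X/E$ $(n\in\mathbb N)$. An equivalence relation on a standard Borel space is \emph{smooth} if it is Borel reducible to equality on some standard Borel space. For equivalence relations $E\subseteq F$ on $X$, $F/E$ denotes the induced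 equivalence relation on $X/E$. Let $E_0$ be the relation of eventual equality on $2^{\omega}$, let $S_2$ act componentwise on $2^\omega$, $\sigma\cdot(x_n)=(\sigma x_n)$, and let $E_0(S_2)$ be the equivalence relation generated by $E_0$ and the orbit equivalence relation of this action. Let $\mu$ be the image on $2^\omega/E_0$ of the $\omega$-th power of the $(\frac12,\frac12)$-measure on $\{0,1\}$. (1) $(2^\omega,E_0)$ is a quotient Borel space, $E_0$ is not smooth, and $\mu$ is a probability measure that takes only the values $0$ and $1$ on Borel sets and vanishes on points. The action of $S_2$ preserves $E_0$; the induced action on $(2^\omega,E_0)$ is by Borel automorphisms, free and $\mu$-preserving, and its orbit equivalence relation is $E_0(S_2)/E_0$. The relation $E_0(S_2)/E_0$ is a countable Borel equivalence relation of index $2$ on $(2^\omega,E_0)$ that is not smooth. (2) On $X=2^\omega\times\{0,1\}$ consider $E=E_0(S_2)\oplus E_0$ and $F=E_0(S_2)\times I(2)$, that is, $$(x,i)\mathrel{E}(y,j)\iff \bigl(i=j=0\text{ and }x\mathrel{E_0(S_2)}y\bigr)\text{ or }\bigl(i=j=1\text{ and }x\mathrel{E_0}y\bigr),\qquad (x,i)\mathrel{F}(y,j)\iff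 x\mathrel{E_0(S_2)}y .$$ Then $E\subseteq F$ are countable Borel equivalence relations on $X$, and $F/E$ is a countable Borel equivalence relation of index $3$ on $(X,E)$. It is smooth: $(2^\omega\times\{0\})/E$ is a Borel transversal, and the map $\varphi$ of $X/E$ induced by $(x,i)\mapsto(x,0)$ is a Borel selector for $F/E$. Moreover $F/E$ is generated by the single Borel map $\varphi$, all of whose nonempty fibres have exactly three points. Nevertheless $F/E$ is not Borel enumerable. -/

import Mathlib

open MeasureTheory

namespace QuotientBorel

/-! ### Quotient Borel spaces -/

/-- `(X, E)` is a quotient Borel space: `X` is standard Borel and `E` is a countable Borel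
equivalence relation on `X`. The underlying set is `Quotient E`, and its Borel subsets are the
measurable sets of the quotient σ-algebra (Mathlib's instance on `Quotient E`). -/
structure IsQuotientBorelSpace (X : Type*) [MeasurableSpace X] (E : Setoid X) : Prop where
  standard : StandardBorelSpace X
  borel : MeasurableSet {p : X × X | E p.1 p.2}
  countable : ∀ x : X, {y : X | E x y}.Countable

/-- Smoothness of an equivalence relation on a standard Borel space: Borel reducibility to
equality on some standard Borel space. -/
def IsSmooth {X : Type*} [MeasurableSpace X] (E : Setoid X) : Prop :=
  ∃ (Y : Type) (_ : MeasurableSpace Y) (_ : StandardBorelSpace Y) (f : X → Y),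
    Measurable f ∧ ∀ x y : X, E x y ↔ f x = f y

section Relations

variable {X Y : Type*} [MeasurableSpace X] [MeasurableSpace Y] {E : Setoid X} {F : Setoid Y}

/-- A Borel binary relation between `(X, E)` and `(Y, F)`: a Borel subset of the product space
`(X × Y, E × F)`, that is, one whose preimage in `X × Y` is Borel. (This is in general weaker
than measurability for the product of the two quotient σ-algebras.) -/
def IsBorelRel (R : Quotient E → Quotient F → Prop) : Prop :=
  MeasurableSet {p : X × Y | R (Quotient.mk E p.1) (Quotient.mk F p.2)}

/-- A Borel function `(X, E) → (Y, F)`: its graph is a Borel relation. -/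
def IsBorelFun (f : Quotient E → Quotient F) : Prop :=
  IsBorelRel fun a b => f a = b

/-- A Borel automorphism of `(X, E)`. -/
def IsBorelAut (e : Equiv.Perm (Quotient E)) : Prop :=
  IsBorelFun (e : Quotient E → Quotient E) ∧ IsBorelFun (e.symm : Quotient E → Quotient E)

/-- A Borel action of a group on `(X, E)`: every group element acts as a Borel automorphism. -/
def IsBorelAction (E : Setoid X) (Γ : Type*) [Group Γ] [MulAction Γ (Quotient E)] : Prop :=
  ∀ γ : Γ, IsBorelAut (MulAction.toPerm γ : Equiv.Perm (Quotient E))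

/-- A countable Borel equivalence relation on the quotient Borel space `(X, E)`. -/
structure IsCountableBorelOver (R : Setoid (Quotient E)) : Prop where
  borel : IsBorelRel fun a b => R a b
  countable : ∀ a, {b | R a b}.Countable

/-- Every class of `R` has exactly `n` elements. -/
def HasIndex {A : Type*} (R : Setoid A) (n : ℕ) : Prop :=
  ∀ a, {b | R a b}.encard = n

/-- `T` is a Borel transversal for `R`: a Borel subset of `(X, E)` that meets every class of `R`
in exactly one point. -/
def IsBorelTransversal (R : Setoid (Quotient E)) (T : Set (Quotient E)) : Prop :=
  MeasurableSet T ∧ ∀ a, ∃! b, b ∈ T ∧ R a b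

/-- Smoothness of a countable Borel equivalence relation on a quotient Borel space. -/
def IsSmoothOver (R : Setoid (Quotient E)) : Prop :=
  ∃ T, IsBorelTransversal R T

/-- `φ` is a Borel selector for `R`. -/
def IsBorelSelector (R : Setoid (Quotient E)) (φ : Quotient E → Quotient E) : Prop :=
  IsBorelFun φ ∧ (∀ a, R a (φ a)) ∧ ∀ a b, R a b → φ a = φ b

/-- `R` is the smallest equivalence relation containing (the graph of) `f`. -/
def IsGeneratedBy {A : Type*} (R : Setoid A) (f : A → A) : Prop :=
  IsLeast {S : Setoid A | ∀ a, S a (f a)} R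

/-- `R` is Borel enumerable: the union of the graphs of countably many Borel endomorphisms. -/
def IsEnumerable (R : Setoid (Quotient E)) : Prop :=
  ∃ f : ℕ → Quotient E → Quotient E, (∀ n, IsBorelFun (f n)) ∧ ∀ a b, R a b ↔ ∃ n, f n a = b

end Relations

/-- For equivalence relations `E ⊆ F` on `X`, the equivalence relation `F / E` on `X / E`. -/
def quotientRel {X : Type*} (E F : Setoid X) (h : E ≤ F) : Setoid (Quotient E) :=
  Setoid.ker (Quotient.map' (s₁ := E) (s₂ := F) id h)

theorem quotientRel_mk {X : Type*} {E F : Setoid X} (h : E ≤ F) (x y : X) :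
    quotientRel E F h (Quotient.mk E x) (Quotient.mk E y) ↔ F x y :=
  Quotient.eq (r := F) (x := x) (y := y)

/-! ### The relation `E₀` and the componentwise action of `S₂` -/

/-- The Cantor space. -/
abbrev Cantor : Type := ℕ → Fin 2

/-- The symmetric group on two elements. Its action on `Cantor` is Mathlib's pointwise one:
`(σ • x) n = σ (x n)`. -/
abbrev S2 : Type := Equiv.Perm (Fin 2)

/-- Eventual equality of binary sequences. -/
def E0 : Setoid Cantor where
  r x y := ∃ n₀, ∀ n ≥ n₀, x n = y n
  iseqv :=
    { refl := fun _ => ⟨0, fun _ _ => rfl⟩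
      symm := fun ⟨k, h⟩ => ⟨k, fun n hn => (h n hn).symm⟩
      trans := fun ⟨k, h⟩ ⟨l, h'⟩ => ⟨max k l, fun n hn =>
        (h n (le_trans (le_max_left k l) hn)).trans (h' n (le_trans (le_max_right k l) hn))⟩ }

theorem E0_smul (σ : S2) {x y : Cantor} (h : E0 x y) : E0 (σ • x) (σ • y) := by
  obtain ⟨k, hk⟩ := h
  exact ⟨k, fun n hn => congrArg σ (hk n hn)⟩

/-- The action of `S₂` on `(2^ω, E₀)` induced by the componentwise action. -/
instance instMulActionQuotientE0 : MulAction S2 (Quotient E0) where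
  smul σ := Quotient.map (fun x => σ • x) fun _ _ h => E0_smul σ h
  one_smul a := Quotient.inductionOn a fun _ => rfl
  mul_smul _ _ a := Quotient.inductionOn a fun _ => rfl

/-- `E₀(S₂)`: the equivalence relation generated by `E₀` and the orbit equivalence relation of the
componentwise action of `S₂`. -/
def E0S2 : Setoid Cantor := E0 ⊔ MulAction.orbitRel S2 Cantor

theorem E0_le_E0S2 : E0 ≤ E0S2 := le_sup_left

/-- Haar measure on the Cantor space: the `ω`-th power of the uniform measure on `{0, 1}`. -/
noncomputable def haarCantor : Measure Cantor :=
  Measure.infinitePi fun _ : ℕ => (PMF.uniformOfFintype (Fin 2)).toMeasure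

/-- The quotient measure on `(2^ω, E₀)`. -/
noncomputable def quotientHaar : Measure (Quotient E0) :=
  haarCantor.map (Quotient.mk E0)

/-! ### The relations `E ⊆ F` on `2^ω × 2` -/

/-- `E = E₀(S₂) ⊕ E₀` on `2^ω × 2`. -/
def relE : Setoid (Cantor × Fin 2) where
  r p q := (p.2 = 0 ∧ q.2 = 0 ∧ E0S2 p.1 q.1) ∨ (p.2 = 1 ∧ q.2 = 1 ∧ E0 p.1 q.1)
  iseqv :=
    { refl := by
        rintro ⟨x, i⟩
        rcases Fin.exists_fin_two.mp ⟨i, rfl⟩ with h | h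
        · exact Or.inl ⟨h, h, E0S2.refl x⟩
        · exact Or.inr ⟨h, h, E0.refl x⟩
      symm := by
        rintro p q (⟨h, h', k⟩ | ⟨h, h', k⟩)
        · exact Or.inl ⟨h', h, E0S2.symm k⟩
        · exact Or.inr ⟨h', h, E0.symm k⟩
      trans := by
        rintro p q r (⟨h, h', k⟩ | ⟨h, h', k⟩) (⟨l, l', m⟩ | ⟨l, l', m⟩)
        · exact Or.inl ⟨h, l', E0S2.trans k m⟩
        · exact absurd (h'.symm.trans l) (by decide)
        · exact absurd (h'.symm.trans l) (by decide)
        · exact Or.inr ⟨h, l', E0.trans k m⟩ }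

/-- `F = E₀(S₂) × I(2)` on `2^ω × 2`, that is, `(x, i) F (y, j) ↔ x E₀(S₂) y`. -/
def relF : Setoid (Cantor × Fin 2) := E0S2.comap Prod.fst

theorem relE_le_relF : relE ≤ relF := by
  rintro p q (⟨_, _, h⟩ | ⟨_, _, h⟩)
  · exact h
  · exact E0_le_E0S2 h

/-- The self-map of `(2^ω × 2, E)` induced by `(x, i) ↦ (x, 0)`. -/
def selectorMap : Quotient relE → Quotient relE :=
  Quotient.map (fun p => (p.1, 0)) fun p q h =>
    Or.inl ⟨rfl, rfl, (relE_le_relF h : relF p q)⟩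

end QuotientBorel

open QuotientBorel

/-! By Kolmogorov's zero-one law the quotient measure `μ` on `2^ω / E₀` takes only the values `0`
and `1`. Since `S₂` preserves `μ` and acts freely, a Borel set that is disjoint from its translate
by the nontrivial element of `S₂` cannot have measure `1`, so it is null. Hence every Borel partial
transversal of `E₀(S₂) / E₀` is null, and countably many of them cannot cover `2^ω / E₀`.

Such a cover would arise from a Borel transversal of `E₀(S₂) / E₀`, by translating it, but also from
Borel maps `f n` enumerating `F / E`: as the selector `φ` is constant on classes, the sets
`{b | f n (φ b) = b}` are partial transversals of `F / E`, they cover, and the level `2^ω × {1}`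
carries a copy of `E₀(S₂) / E₀`. -/

namespace QuotientBorel

open Filter ProbabilityTheory

/-- Countably many Borel partial transversals of `R` cover the space, where a partial transversal
is a set that meets each class in at most one point. This is a common consequence of smoothness of
an orbit equivalence relation and of Borel enumerability of a relation with a Borel selector. -/
def HasPartialTransversalCover {A : Type*} [MeasurableSpace A] (R : Setoid A) : Prop :=
  ∃ B : ℕ → Set A,
    (∀ n, MeasurableSet (B n)) ∧ (∀ n, (B n).InjOn (Quotient.mk R)) ∧ ⋃ n, B n = Set.univ

namespace HasPartialTransversalCover

variable {A A' : Type*} [MeasurableSpace A] [MeasurableSpace A']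

theorem of_countable {ι : Type*} [Countable ι] [Nonempty ι] {R : Setoid A} {B : ι → Set A}
    (hB : ∀ i, MeasurableSet (B i)) (hinj : ∀ i, (B i).InjOn (Quotient.mk R))
    (hcover : ⋃ i, B i = Set.univ) : HasPartialTransversalCover R := by
  obtain ⟨e, he⟩ := exists_surjective_nat ι
  exact ⟨B ∘ e, fun n => hB (e n), fun n => hinj (e n), (he.iUnion_comp B).trans hcover⟩

theorem comap {R : Setoid A} {f : A' → A} (hR : HasPartialTransversalCover R)
    (hf : Measurable f) (hinj : f.Injective) : HasPartialTransversalCover (R.comap f) := by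
  obtain ⟨B, hB, hBinj, hcover⟩ := hR
  refine ⟨fun n => f ⁻¹' B n, fun n => hf (hB n), fun n a ha b hb hab => ?_, ?_⟩
  · have hab' : R (f a) (f b) := Quotient.exact (s := R.comap f) hab
    exact hinj (hBinj n ha hb (Quotient.sound hab'))
  · rw [← Set.preimage_iUnion, hcover, Set.preimage_univ]

end HasPartialTransversalCover

section ZeroOneMeasures

variable {A B : Type*} [MeasurableSpace A] [MeasurableSpace B]

theorem isZeroOneMeasure_map {μ : Measure A} [IsZeroOneMeasure μ] {f : A → B}
    (hf : Measurable f) : IsZeroOneMeasure (μ.map f) where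
  zero_one₀ s hs := by
    rw [Measure.map_apply hf hs]
    exact μ.zero_one _

theorem measure_eq_zero_of_disjoint_preimage {μ : Measure A} [IsZeroOneMeasure μ] {T : A → A}
    (hT : MeasurePreserving T μ μ) {s : Set A} (hs : MeasurableSet s)
    (hdisj : Disjoint s (T ⁻¹' s)) : μ s = 0 := by
  refine (μ.zero_one s).resolve_right fun h => ?_
  have hpre : μ (T ⁻¹' s) = 1 := (hT.measure_preimage hs.nullMeasurableSet).trans h
  have hinter := IsZeroOneMeasure.measure_inter_eq_one hs (hT.measurable hs) h hpre
  rw [hdisj.inter_eq, measure_empty] at hinter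
  exact zero_ne_one hinter

theorem not_hasPartialTransversalCover {μ : Measure A} [IsZeroOneMeasure μ] [NeZero μ]
    {R : Setoid A} {T : A → A} (hT : MeasurePreserving T μ μ) (hRT : ∀ a, R a (T a))
    (hfix : ∀ a, T a ≠ a) : ¬ HasPartialTransversalCover R := by
  rintro ⟨B, hB, hinj, hcover⟩
  have hnull (n : ℕ) : μ (B n) = 0 :=
    measure_eq_zero_of_disjoint_preimage hT (hB n) <| Set.disjoint_left.mpr fun a ha hTa =>
      hfix a (hinj n ha hTa (Quotient.sound (hRT a))).symm
  refine NeZero.ne μ (Measure.measure_univ_eq_zero.mp ?_)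
  rw [← hcover]
  exact measure_iUnion_null hnull

/-- A reduction to equality on a standard Borel space `Y` pushes a zero-one measure on `X / E` to
a zero-one measure on `Y`, that is, to a Dirac measure, so a single point of `X / E` carries it. -/
theorem not_isSmooth_of_isZeroOneMeasure {X : Type*} [MeasurableSpace X] {E : Setoid X}
    (μ : Measure (Quotient E)) [IsZeroOneMeasure μ] [NeZero μ] [NullSingletonClass μ] :
    ¬ IsSmooth E := by
  rintro ⟨Y, _, _, f, hf, hE⟩
  let g : Quotient E → Y := Quotient.lift f fun x y h => (hE x y).mp h
  have hg : Measurable g := measurable_from_quotient.mpr hf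
  have hinj : g.Injective := fun a b => Quotient.inductionOn₂ a b fun x y h =>
    Quotient.sound ((hE x y).mpr h)
  have := isZeroOneMeasure_map (μ := μ) hg
  have : NeZero (μ.map g) := ⟨(Measure.map_ne_zero_iff hg.aemeasurable).mpr (NeZero.ne μ)⟩
  obtain ⟨y, hy⟩ := IsZeroOneMeasure.exists_eq_dirac (μ := μ.map g)
  have hone : μ (g ⁻¹' {y}) = 1 := by
    rw [← Measure.map_apply hg (measurableSet_singleton y), hy,
      Measure.dirac_apply_of_mem (Set.mem_singleton y)]
  have hzero : μ (g ⁻¹' {y}) = 0 :=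
    (Set.subsingleton_singleton.preimage hinj).measure_zero μ
  exact zero_ne_one (hzero.symm.trans hone)

end ZeroOneMeasures

section ProductMeasures

theorem measurableSet_limsup_comap_eval {Ω : ℕ → Type*} [∀ n, MeasurableSpace (Ω n)]
    [∀ n, Nonempty (Ω n)] {B : Set (∀ n, Ω n)} (hB : MeasurableSet B)
    (htail : ∀ x y : ∀ n, Ω n, (∀ᶠ n in atTop, x n = y n) → x ∈ B → y ∈ B) :
    MeasurableSet[limsup
      (fun n => MeasurableSpace.comap (fun x : ∀ n, Ω n => x n) inferInstance) atTop] B := by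
  rw [limsup_eq_iInf_iSup_of_nat, MeasurableSpace.measurableSet_iInf]
  intro k
  -- Overwriting the first `k` coordinates by constants exhibits `B` as a preimage of itself.
  let g : (∀ n, Ω n) → ∀ n, Ω n := fun x n => if k ≤ n then x n else Classical.arbitrary (Ω n)
  have hg : Measurable[⨆ n, ⨆ _ : k ≤ n,
      MeasurableSpace.comap (fun x : ∀ n, Ω n => x n) inferInstance] g := by
    refine @measurable_pi_lambda _ _ _ (_) _ _ fun n => ?_
    by_cases hn : k ≤ n
    · simp only [g, hn, if_true]
      exact (comap_measurable _).mono (le_iSup₂_of_le (f := fun n (_ : k ≤ n) =>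
        MeasurableSpace.comap (fun x : ∀ n, Ω n => x n) inferInstance) n hn le_rfl) le_rfl
    · simp only [g, hn, if_false]
      exact measurable_const
  have hxg (x : ∀ n, Ω n) : ∀ᶠ n in atTop, x n = g x n := by
    filter_upwards [eventually_ge_atTop k] with n hn
    exact (if_pos hn).symm
  have hBg : g ⁻¹' B = B := Set.ext fun x =>
    ⟨htail _ _ ((hxg x).mono fun _ => Eq.symm), htail _ _ (hxg x)⟩
  exact hBg ▸ hg hB

theorem infinitePi_eq_zero_or_one_of_tail {Ω : ℕ → Type*} [∀ n, MeasurableSpace (Ω n)]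
    (μ : ∀ n, Measure (Ω n)) [∀ n, IsProbabilityMeasure (μ n)] {B : Set (∀ n, Ω n)}
    (hB : MeasurableSet B)
    (htail : ∀ x y : ∀ n, Ω n, (∀ᶠ n in atTop, x n = y n) → x ∈ B → y ∈ B) :
    Measure.infinitePi μ B = 0 ∨ Measure.infinitePi μ B = 1 := by
  have (n : ℕ) : Nonempty (Ω n) := nonempty_of_isProbabilityMeasure (μ n)
  have hind : iIndep (fun n => MeasurableSpace.comap (fun x : ∀ n, Ω n => x n) inferInstance)
      (Measure.infinitePi μ) :=
    iIndepFun_infinitePi (X := fun _ i => i) fun _ => measurable_id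
  exact measure_zero_or_one_of_measurableSet_limsup_atTop
    (fun n => (measurable_pi_apply n).comap_le) hind (measurableSet_limsup_comap_eval hB htail)

variable {ι : Type*} {Ω : ι → Type*} [∀ i, MeasurableSpace (Ω i)] (μ : ∀ i, Measure (Ω i))
  [∀ i, IsProbabilityMeasure (μ i)]

theorem infinitePi_singleton_eq_zero [Infinite ι] [∀ i, MeasurableSingletonClass (Ω i)]
    {x : ∀ i, Ω i} {c : ENNReal} (hc : c < 1) (h : ∀ i, μ i {x i} ≤ c) :
    Measure.infinitePi μ {x} = 0 := by
  have hle (k : ℕ) : Measure.infinitePi μ {x} ≤ c ^ k := by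
    obtain ⟨s, rfl⟩ := Infinite.exists_subset_card_eq ι k
    calc Measure.infinitePi μ {x}
        ≤ Measure.infinitePi μ (Set.pi s fun i => {x i}) :=
          measure_mono (Set.singleton_subset_iff.mpr fun _ _ => rfl)
      _ = ∏ i ∈ s, μ i {x i} := Measure.infinitePi_pi _ fun i _ => measurableSet_singleton _
      _ ≤ c ^ s.card := Finset.prod_le_pow_card _ _ _ fun i _ => h i
  exact le_antisymm (ge_of_tendsto' (ENNReal.tendsto_pow_atTop_nhds_zero_of_lt_one hc) hle)
    zero_le

instance smulInvariantMeasure_infinitePi {G : Type*} [∀ i, SMul G (Ω i)]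
    [∀ i, MeasurableConstSMul G (Ω i)] [∀ i, SMulInvariantMeasure G (Ω i) (μ i)] :
    SMulInvariantMeasure G (∀ i, Ω i) (Measure.infinitePi μ) where
  measure_preimage_smul g s hs := by
    have hmap := Measure.infinitePi_map_pi μ fun i => measurable_const_smul (α := Ω i) g
    simp only [(measurePreserving_smul g (μ _)).map_eq] at hmap
    rw [← Measure.map_apply (measurable_const_smul g) hs]
    exact congrArg (· s) hmap

instance smulInvariantMeasure_uniformOfFintype {G α : Type*} [Group G] [MulAction G α]
    [Fintype α] [Nonempty α] [MeasurableSpace α] [MeasurableConstSMul G α] :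
    SMulInvariantMeasure G α (PMF.uniformOfFintype α).toMeasure where
  measure_preimage_smul g s hs := by
    classical
    rw [PMF.toMeasure_uniformOfFintype_apply _ hs,
      PMF.toMeasure_uniformOfFintype_apply _ (measurable_const_smul g hs)]
    exact congrArg (fun k : ℕ => (k : ENNReal) / Fintype.card α) <|
      Fintype.card_congr ((MulAction.toPerm g).subtypeEquiv fun _ => Iff.rfl)

end ProductMeasures

section BorelFunctions

variable {X Y : Type*} [MeasurableSpace X] [MeasurableSpace Y] {E : Setoid X} {F : Setoid Y}

namespace IsQuotientBorelSpace

theorem comap [StandardBorelSpace X] (hF : IsQuotientBorelSpace Y F) {f : X → Y}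
    (hf : Measurable f) (hfib : ∀ y, (f ⁻¹' {y}).Countable) :
    IsQuotientBorelSpace X (F.comap f) where
  standard := inferInstance
  borel := (hf.prodMap hf) hF.borel
  countable x := by
    refine ((hF.countable (f x)).biUnion fun y _ => hfib y).mono fun z hz => ?_
    exact Set.mem_biUnion (show F (f x) (f z) from hz) rfl

theorem of_le {F : Setoid X} (hF : IsQuotientBorelSpace X F) (h : E ≤ F)
    (hE : MeasurableSet {p : X × X | E p.1 p.2}) : IsQuotientBorelSpace X E where
  standard := hF.standard
  borel := hE
  countable x := (hF.countable x).mono fun _ hy => h hy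

theorem isCountableBorelOver {F : Setoid X} (hF : IsQuotientBorelSpace X F) (h : E ≤ F) :
    IsCountableBorelOver (quotientRel E F h) where
  borel := by simpa only [IsBorelRel, quotientRel_mk] using hF.borel
  countable a := by
    induction a using Quotient.inductionOn with | _ x => ?_
    refine ((hF.countable x).image (Quotient.mk E)).mono fun b hb => ?_
    induction b using Quotient.inductionOn with | _ y => ?_
    exact ⟨y, (quotientRel_mk h x y).mp hb, rfl⟩

theorem nullSingletonClass_map_mk [MeasurableSingletonClass X] (hE : IsQuotientBorelSpace X E)
    (μ : Measure X) [NullSingletonClass μ] : NullSingletonClass (μ.map (Quotient.mk E)) where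
  measure_singleton a := by
    induction a using Quotient.inductionOn with | _ x => ?_
    have hclass : (Quotient.mk E ⁻¹' {Quotient.mk E x}).Countable :=
      (hE.countable x).mono fun y hy => E.symm (Quotient.exact hy)
    have hmeas : MeasurableSet {Quotient.mk E x} := measurableSet_quotient.mpr hclass.measurableSet
    rw [Measure.map_apply measurable_quotient_mk'' hmeas]
    exact hclass.measure_zero μ

end IsQuotientBorelSpace

theorem measurableSet_setOf_apply_mk_eq_mk {Z : Type*} [MeasurableSpace Z]
    {f : Quotient E → Quotient F} (hf : IsBorelFun f) {u : Z → X} {v : Z → Y} (hu : Measurable u)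
    (hv : Measurable v) :
    MeasurableSet {z | f (Quotient.mk E (u z)) = Quotient.mk F (v z)} :=
  (hu.prodMk hv) hf

theorem isBorelFun_of_apply_mk (hF : MeasurableSet {p : Y × Y | F p.1 p.2})
    {f : Quotient E → Quotient F} {u : X → Y} (hu : Measurable u)
    (hfu : ∀ x, f (Quotient.mk E x) = Quotient.mk F (u x)) : IsBorelFun f := by
  simp only [IsBorelFun, IsBorelRel, hfu, Quotient.eq]
  exact (hu.prodMap measurable_id) hF

end BorelFunctions

namespace IsBorelSelector

variable {X : Type*} [MeasurableSpace X] {E : Setoid X} {R : Setoid (Quotient E)}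
  {φ : Quotient E → Quotient E}

theorem apply_eq_apply_iff (hφ : IsBorelSelector R φ) {a b : Quotient E} :
    φ a = φ b ↔ R a b :=
  ⟨fun h => R.trans (hφ.2.1 a) (h ▸ R.symm (hφ.2.1 b)), hφ.2.2 a b⟩

theorem isBorelTransversal_fixedPoints (hφ : IsBorelSelector R φ) :
    IsBorelTransversal R (Function.fixedPoints φ) := by
  refine ⟨measurableSet_quotient.mpr
    (measurableSet_setOf_apply_mk_eq_mk hφ.1 measurable_id measurable_id),
    fun a => ⟨φ a, ⟨(hφ.2.2 a (φ a) (hφ.2.1 a)).symm, hφ.2.1 a⟩, ?_⟩⟩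
  rintro b ⟨hb, hab⟩
  exact hb.symm.trans (hφ.2.2 a b hab).symm

theorem isGeneratedBy (hφ : IsBorelSelector R φ) : IsGeneratedBy R φ := by
  refine ⟨hφ.2.1, fun S hS a b hab => ?_⟩
  have hb : S (φ a) b := hφ.2.2 a b hab ▸ S.symm (hS b)
  exact S.trans (hS a) hb

theorem encard_fibre (hφ : IsBorelSelector R φ) {n : ℕ} (hR : HasIndex R n) (a : Quotient E) :
    {b | φ b = φ a}.encard = n := by
  simp only [eq_comm (b := φ a), hφ.apply_eq_apply_iff]
  exact hR a

/-- If Borel maps `f n` enumerate `R`, then `{b | f n (φ b) = b}` is a partial transversal, since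
`φ` is constant on classes. -/
theorem hasPartialTransversalCover (hφ : IsBorelSelector R φ) {u : X → X} (hu : Measurable u)
    (hφu : ∀ x, φ (Quotient.mk E x) = Quotient.mk E (u x)) (hR : IsEnumerable R) :
    HasPartialTransversalCover R := by
  obtain ⟨f, hf, hfR⟩ := hR
  refine ⟨fun n => {b | f n (φ b) = b}, fun n => measurableSet_quotient.mpr ?_,
    fun n a ha b hb hab => ?_, Set.eq_univ_of_forall fun b => Set.mem_iUnion.mpr ?_⟩
  · simpa only [Set.preimage_ofPred_eq, Quotient.mk''_eq_mk, hφu, id_eq] using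
      measurableSet_setOf_apply_mk_eq_mk (hf n) hu measurable_id
  · have hab' : φ a = φ b := hφ.2.2 a b (Quotient.exact hab)
    exact ha.symm.trans ((congrArg (f n) hab').trans hb)
  · exact (hfR (φ b) b).mp (R.symm (hφ.2.1 b))

end IsBorelSelector

section GroupActions

theorem hasIndex_orbitRel (G A : Type*) [Group G] [Finite G] [MulAction G A]
    [IsCancelSMul G A] : HasIndex (MulAction.orbitRel G A) (Nat.card G) := by
  intro a
  have horbit : {b | MulAction.orbitRel G A a b} = (fun g : G => g • a) '' Set.univ := by
    rw [Set.image_univ]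
    ext b
    exact MulAction.orbitRel_apply.trans MulAction.mem_orbit_symm
  have hinj : (fun g : G => g • a).Injective := fun g g' h => IsCancelSMul.right_cancel g g' a h
  rw [horbit, hinj.encard_image, Set.encard_univ, ENat.card_eq_coe_natCard]

/-- The translates of a transversal are partial transversals, and they cover the space. -/
theorem hasPartialTransversalCover_of_isSmoothOver {X G : Type*} [MeasurableSpace X]
    {E : Setoid X} [Group G] [Countable G] [MulAction G (Quotient E)]
    [MeasurableConstSMul G (Quotient E)]
    (h : IsSmoothOver (MulAction.orbitRel G (Quotient E))) :
    HasPartialTransversalCover (MulAction.orbitRel G (Quotient E)) := by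
  obtain ⟨T, hT, huniq⟩ := h
  refine .of_countable (B := fun g : G => (g • ·) ⁻¹' T) (fun g => measurable_const_smul g hT)
    (fun g a ha b hb hab => ?_) (Set.eq_univ_of_forall fun a => Set.mem_iUnion.mpr ?_)
  · have horbit (c : Quotient E) : MulAction.orbitRel G (Quotient E) c (g • c) :=
      Setoid.symm' _ (MulAction.mem_orbit c g)
    have hga := horbit a
    have hgb := Setoid.trans' _ (Quotient.exact hab) (horbit b)
    exact smul_left_cancel g ((huniq a).unique ⟨ha, hga⟩ ⟨hb, hgb⟩)
  · obtain ⟨b, ⟨hbT, g, rfl⟩, -⟩ := huniq a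
    exact ⟨g⁻¹, by simpa only [Set.mem_preimage, inv_smul_smul] using hbT⟩

variable {X G : Type*} [Group G] [MulAction G X] {E : Setoid X} [MulAction G (Quotient E)]

/-- The action of `G` on `X / E` is the one induced by its action on `X`, which therefore
preserves `E`. -/
def IsInducedAction (G : Type*) {X : Type*} [Group G] [MulAction G X] (E : Setoid X)
    [MulAction G (Quotient E)] : Prop :=
  ∀ (g : G) (x : X), g • Quotient.mk E x = Quotient.mk E (g • x)

theorem IsInducedAction.sup_orbitRel (h : IsInducedAction G E) :
    E ⊔ MulAction.orbitRel G X = (MulAction.orbitRel G (Quotient E)).comap (Quotient.mk E) := by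
  refine le_antisymm (sup_le (fun {x y} hxy => ?_) fun {x y} hxy => ?_) fun {x y} hxy => ?_
  · exact (Setoid.comap_rel _ _ x y).mpr (Quotient.sound hxy ▸ Setoid.refl' _ _)
  · obtain ⟨g, rfl⟩ := hxy
    exact ⟨g, h g y⟩
  · obtain ⟨g, hg⟩ := hxy
    have hE : E (g • y) x := Quotient.exact ((h g y).symm.trans hg)
    have hG : MulAction.orbitRel G X (g • y) y := MulAction.mem_orbit y g
    exact Setoid.trans' _ (le_sup_left (a := E) (E.symm hE)) (le_sup_right (a := E) hG)

theorem IsInducedAction.sup_orbitRel_iff (h : IsInducedAction G E) {x y : X} :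
    (E ⊔ MulAction.orbitRel G X) x y ↔ ∃ g : G, E (g • x) y := by
  rw [h.sup_orbitRel, Setoid.comap_rel, Setoid.comm', MulAction.orbitRel_apply,
    MulAction.mem_orbit_iff]
  simp only [h _ x, Quotient.eq]

theorem IsInducedAction.orbitRel_eq_quotientRel (h : IsInducedAction G E) :
    MulAction.orbitRel G (Quotient E) = quotientRel E (E ⊔ MulAction.orbitRel G X) le_sup_left := by
  ext a b
  induction a, b using Quotient.inductionOn₂ with | _ x y => ?_
  rw [quotientRel_mk, h.sup_orbitRel]
  rfl

variable [MeasurableSpace X] [MeasurableConstSMul G X]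

theorem IsInducedAction.measurableConstSMul (h : IsInducedAction G E) :
    MeasurableConstSMul G (Quotient E) where
  measurable_const_smul g := measurable_from_quotient.mpr <| by
    simp only [Function.comp_def, Quotient.mk''_eq_mk, h g]
    exact measurable_quotient_mk''.comp (measurable_const_smul g)

theorem IsInducedAction.smulInvariantMeasure_map_mk (h : IsInducedAction G E) (μ : Measure X)
    [SMulInvariantMeasure G X μ] : SMulInvariantMeasure G (Quotient E) (μ.map (Quotient.mk E)) :=
  have := h.measurableConstSMul
  smulInvariantMeasure_map μ _ (fun g x => (h g x).symm) measurable_quotient_mk''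

theorem IsInducedAction.isBorelAction (h : IsInducedAction G E)
    (hE : MeasurableSet {p : X × X | E p.1 p.2}) : IsBorelAction E G := fun g =>
  ⟨isBorelFun_of_apply_mk hE (measurable_const_smul g) (h g),
    isBorelFun_of_apply_mk hE (measurable_const_smul g⁻¹) (h g⁻¹)⟩

theorem IsInducedAction.isQuotientBorelSpace_sup_orbitRel [Countable G]
    (h : IsInducedAction G E) (hE : IsQuotientBorelSpace X E) :
    IsQuotientBorelSpace X (E ⊔ MulAction.orbitRel G X) where
  standard := hE.standard
  borel := by
    simp only [h.sup_orbitRel_iff, Set.ofPred_exists]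
    exact .iUnion fun g => ((measurable_const_smul g).prodMap measurable_id) hE.borel
  countable x := by
    simp only [h.sup_orbitRel_iff, Set.ofPred_exists]
    exact Set.countable_iUnion fun g => hE.countable (g • x)

end GroupActions

section CantorSpace

instance measurableConstSMul_of_discrete {M α : Type*} [SMul M α] [MeasurableSpace α]
    [DiscreteMeasurableSpace α] : MeasurableConstSMul M α :=
  ⟨fun _ => .of_discrete⟩

theorem measurableSet_E0 : MeasurableSet {p : Cantor × Cantor | E0 p.1 p.2} := by
  change MeasurableSet {p : Cantor × Cantor | ∃ n₀, ∀ n ≥ n₀, p.1 n = p.2 n}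
  simp only [Set.ofPred_exists, Set.ofPred_forall]
  exact .iUnion fun _ => .iInter fun n => .iInter fun _ => measurableSet_eq_fun
    ((measurable_pi_apply n).comp measurable_fst) ((measurable_pi_apply n).comp measurable_snd)

theorem countable_E0_class (x : Cantor) : {y | E0 x y}.Countable := by
  have h : {y | E0 x y} ⊆ ⋃ k : ℕ,
      Set.range fun (s : Fin k → Fin 2) (n : ℕ) => if hn : n < k then s ⟨n, hn⟩ else x n := by
    rintro y ⟨k, hk⟩
    refine Set.mem_iUnion.mpr ⟨k, fun i => y i, funext fun n => ?_⟩
    by_cases hn : n < k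
    · exact dif_pos hn
    · exact (dif_neg hn).trans (hk n (not_lt.mp hn))
  exact (Set.countable_iUnion fun k => Set.countable_range _).mono h

theorem isQuotientBorelSpace_E0 : IsQuotientBorelSpace Cantor E0 :=
  ⟨inferInstance, measurableSet_E0, countable_E0_class⟩

theorem isInducedAction_S2_E0 : IsInducedAction S2 E0 := fun _ _ => rfl

theorem isQuotientBorelSpace_E0S2 : IsQuotientBorelSpace Cantor E0S2 :=
  isInducedAction_S2_E0.isQuotientBorelSpace_sup_orbitRel isQuotientBorelSpace_E0

theorem orbitRel_S2_eq_quotientRel :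
    MulAction.orbitRel S2 (Quotient E0) = quotientRel E0 E0S2 E0_le_E0S2 :=
  isInducedAction_S2_E0.orbitRel_eq_quotientRel

theorem eq_one_of_smul_eq (σ : S2) (a : Quotient E0) (h : σ • a = a) : σ = 1 := by
  induction a using Quotient.inductionOn with | _ x => ?_
  obtain ⟨n, hn⟩ : E0 (σ • x) x := Quotient.exact h
  have hfree : ∀ (τ : S2) (i : Fin 2), τ i = i → τ = 1 := by decide
  exact hfree σ (x n) (hn n le_rfl)

instance isCancelSMul_S2 : IsCancelSMul S2 (Quotient E0) :=
  isCancelSMul_iff_eq_one_of_smul_eq.mpr eq_one_of_smul_eq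

theorem hasIndex_quotientRel_E0S2 : HasIndex (quotientRel E0 E0S2 E0_le_E0S2) 2 := by
  have hcard : Nat.card S2 = 2 := by rw [Nat.card_eq_fintype_card]; rfl
  have h := hasIndex_orbitRel S2 (Quotient E0)
  rwa [hcard, orbitRel_S2_eq_quotientRel] at h

instance isProbabilityMeasure_haarCantor : IsProbabilityMeasure haarCantor :=
  inferInstanceAs (IsProbabilityMeasure (Measure.infinitePi _))

instance smulInvariantMeasure_haarCantor : SMulInvariantMeasure S2 Cantor haarCantor :=
  smulInvariantMeasure_infinitePi _

instance nullSingletonClass_haarCantor : NullSingletonClass haarCantor where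
  measure_singleton x := by
    refine infinitePi_singleton_eq_zero _ ENNReal.one_half_lt_one fun n => ?_
    simp

instance isProbabilityMeasure_quotientHaar : IsProbabilityMeasure quotientHaar :=
  Measure.isProbabilityMeasure_map measurable_quotient_mk''.aemeasurable

instance isZeroOneMeasure_quotientHaar : IsZeroOneMeasure quotientHaar where
  zero_one₀ A hA := by
    rw [quotientHaar, Measure.map_apply measurable_quotient_mk'' hA]
    refine infinitePi_eq_zero_or_one_of_tail _ (measurable_quotient_mk'' hA) fun x y hxy hx => ?_
    have hmk : Quotient.mk E0 x = Quotient.mk E0 y :=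
      Quotient.sound (eventually_atTop.mp hxy)
    exact Set.mem_preimage.mpr (hmk ▸ hx : Quotient.mk E0 y ∈ A)

instance nullSingletonClass_quotientHaar : NullSingletonClass quotientHaar :=
  isQuotientBorelSpace_E0.nullSingletonClass_map_mk haarCantor

instance measurableConstSMul_S2 : MeasurableConstSMul S2 (Quotient E0) :=
  isInducedAction_S2_E0.measurableConstSMul

instance smulInvariantMeasure_quotientHaar : SMulInvariantMeasure S2 (Quotient E0) quotientHaar :=
  isInducedAction_S2_E0.smulInvariantMeasure_map_mk haarCantor

theorem not_hasPartialTransversalCover_E0S2 :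
    ¬ HasPartialTransversalCover (quotientRel E0 E0S2 E0_le_E0S2) := by
  obtain ⟨σ, hσ⟩ := exists_ne (1 : S2)
  rw [← orbitRel_S2_eq_quotientRel]
  exact not_hasPartialTransversalCover (measurePreserving_smul σ quotientHaar)
    (fun a => Setoid.symm' _ (MulAction.mem_orbit a σ)) fun a h => hσ (eq_one_of_smul_eq σ a h)

theorem not_isSmoothOver_E0S2 : ¬ IsSmoothOver (quotientRel E0 E0S2 E0_le_E0S2) := by
  intro h
  refine not_hasPartialTransversalCover_E0S2 ?_
  rw [← orbitRel_S2_eq_quotientRel] at h ⊢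
  exact hasPartialTransversalCover_of_isSmoothOver h

end CantorSpace

section TwoLevels

theorem isQuotientBorelSpace_relF : IsQuotientBorelSpace (Cantor × Fin 2) relF :=
  isQuotientBorelSpace_E0S2.comap measurable_fst fun x => by
    have : Prod.fst ⁻¹' {x} = Set.range (Prod.mk x : Fin 2 → Cantor × Fin 2) := by
      ext ⟨y, i⟩
      simp [eq_comm]
    exact this ▸ Set.countable_range _

theorem measurableSet_relE :
    MeasurableSet {p : (Cantor × Fin 2) × Cantor × Fin 2 | relE p.1 p.2} := by
  have hfst : Measurable fun p : (Cantor × Fin 2) × Cantor × Fin 2 => (p.1.1, p.2.1) :=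
    measurable_fst.prodMap measurable_fst
  have hlevel (i : Fin 2) :
      MeasurableSet {p : (Cantor × Fin 2) × Cantor × Fin 2 | p.1.2 = i ∧ p.2.2 = i} :=
    ((measurable_snd.comp measurable_fst) (measurableSet_singleton i)).inter
      ((measurable_snd.comp measurable_snd) (measurableSet_singleton i))
  convert ((hlevel 0).inter (hfst isQuotientBorelSpace_E0S2.borel)).union
    ((hlevel 1).inter (hfst measurableSet_E0)) using 1
  ext p
  exact or_congr and_assoc.symm and_assoc.symm

theorem isQuotientBorelSpace_relE : IsQuotientBorelSpace (Cantor × Fin 2) relE :=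
  isQuotientBorelSpace_relF.of_le relE_le_relF measurableSet_relE

theorem relE_zero_iff {x y : Cantor} : relE (x, 0) (y, 0) ↔ E0S2 x y :=
  ⟨fun h => relE_le_relF h, fun h => Or.inl ⟨rfl, rfl, h⟩⟩

theorem relE_one_iff {x y : Cantor} : relE (x, 1) (y, 1) ↔ E0 x y :=
  ⟨fun h => (h.resolve_left fun h => absurd h.1 one_ne_zero).2.2, fun h => Or.inr ⟨rfl, rfl, h⟩⟩

theorem snd_eq_of_relE {p q : Cantor × Fin 2} (h : relE p q) : p.2 = q.2 := by
  rcases h with ⟨hp, hq, -⟩ | ⟨hp, hq, -⟩ <;> exact hp.trans hq.symm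

/-- The embedding of `(2^ω, E₀)` into `(2^ω × 2, E)` as the level `2^ω × {1}`, along which `F / E`
restricts to `E₀(S₂) / E₀`. -/
def levelOne : Quotient E0 → Quotient relE :=
  Quotient.map (fun x => (x, 1)) fun _ _ => relE_one_iff.mpr

theorem measurable_levelOne : Measurable levelOne :=
  measurable_from_quotient.mpr <|
    measurable_quotient_mk''.comp (measurable_id.prodMk measurable_const)

theorem injective_levelOne : levelOne.Injective := fun a b =>
  Quotient.inductionOn₂ a b fun _ _ h => Quotient.sound (relE_one_iff.mp (Quotient.exact h))

theorem comap_levelOne_quotientRel :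
    (quotientRel relE relF relE_le_relF).comap levelOne = quotientRel E0 E0S2 E0_le_E0S2 := by
  ext a b
  induction a, b using Quotient.inductionOn₂ with | _ x y => ?_
  exact (quotientRel_mk relE_le_relF (x, 1) (y, 1)).trans (quotientRel_mk E0_le_E0S2 x y).symm

theorem setOf_quotientRel_relF (x : Cantor) (i : Fin 2) :
    {b | quotientRel relE relF relE_le_relF (Quotient.mk relE (x, i)) b} =
      insert (Quotient.mk relE (x, 0))
        (levelOne '' {c | quotientRel E0 E0S2 E0_le_E0S2 (Quotient.mk E0 x) c}) := by
  refine Set.Subset.antisymm (fun b hb => ?_) (Set.insert_subset ?_ ?_)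
  · induction b using Quotient.inductionOn with | _ q => ?_
    obtain ⟨y, j⟩ := q
    have hxy : E0S2 x y := (quotientRel_mk relE_le_relF (x, i) (y, j)).mp hb
    rcases Fin.exists_fin_two.mp ⟨j, rfl⟩ with rfl | rfl
    · exact Or.inl (Quotient.sound (relE_zero_iff.mpr (E0S2.symm hxy)))
    · exact Or.inr ⟨Quotient.mk E0 y, (quotientRel_mk _ _ _).mpr hxy, rfl⟩
  · exact (quotientRel_mk _ _ _).mpr (E0S2.refl x)
  · rintro _ ⟨c, hc, rfl⟩
    induction c using Quotient.inductionOn with | _ y => ?_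
    exact (quotientRel_mk _ _ _).mpr ((quotientRel_mk _ x y).mp hc)

theorem mk_zero_notMem_range_levelOne (x : Cantor) :
    Quotient.mk relE (x, 0) ∉ Set.range levelOne := by
  rintro ⟨c, hc⟩
  induction c using Quotient.inductionOn with | _ y => ?_
  exact one_ne_zero (snd_eq_of_relE (Quotient.exact hc))

theorem hasIndex_quotientRel_relF : HasIndex (quotientRel relE relF relE_le_relF) 3 := by
  intro a
  induction a using Quotient.inductionOn with | _ p => ?_
  rw [setOf_quotientRel_relF, Set.encard_insert_of_notMem fun h =>
    mk_zero_notMem_range_levelOne p.1 (Set.image_subset_range _ _ h),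
    injective_levelOne.encard_image, hasIndex_quotientRel_E0S2]
  norm_num

theorem isBorelSelector_selectorMap :
    IsBorelSelector (quotientRel relE relF relE_le_relF) selectorMap := by
  refine ⟨isBorelFun_of_apply_mk measurableSet_relE (measurable_fst.prodMk measurable_const)
    fun _ => rfl, fun a => ?_, fun a b hab => ?_⟩
  · induction a using Quotient.inductionOn with | _ p => ?_
    exact (quotientRel_mk _ _ _).mpr (E0S2.refl p.1)
  · induction a, b using Quotient.inductionOn₂ with | _ p q => ?_
    exact Quotient.sound (relE_zero_iff.mpr ((quotientRel_mk _ p q).mp hab))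

theorem fixedPoints_selectorMap :
    Function.fixedPoints selectorMap = Quotient.mk relE '' {p | p.2 = 0} := by
  refine Set.Subset.antisymm (fun a ha => ?_) ?_
  · induction a using Quotient.inductionOn with | _ p => ?_
    exact ⟨(p.1, 0), rfl, ha⟩
  · rintro _ ⟨⟨x, _⟩, rfl, rfl⟩
    rfl

theorem isBorelTransversal_zero : IsBorelTransversal (quotientRel relE relF relE_le_relF)
    (Quotient.mk relE '' {p | p.2 = 0}) :=
  fixedPoints_selectorMap ▸ isBorelSelector_selectorMap.isBorelTransversal_fixedPoints

theorem not_isEnumerable_quotientRel_relF :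
    ¬ IsEnumerable (quotientRel relE relF relE_le_relF) := by
  intro h
  have hcover : HasPartialTransversalCover (quotientRel relE relF relE_le_relF) :=
    isBorelSelector_selectorMap.hasPartialTransversalCover
      (measurable_fst.prodMk measurable_const) (fun _ => rfl) h
  have hrestrict := hcover.comap measurable_levelOne injective_levelOne
  rw [comap_levelOne_quotientRel] at hrestrict
  exact not_hasPartialTransversalCover_E0S2 hrestrict

end TwoLevels

end QuotientBorel

theorem mainTheorem4 :
    -- `(2^ω, E₀)` is a nonsmooth quotient Borel space, and its quotient Haar measure is
    -- two-valued (ergodicity) and nonatomic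
    (IsQuotientBorelSpace Cantor E0 ∧ ¬ IsSmooth E0 ∧
      (∀ A : Set (Quotient E0), MeasurableSet A → quotientHaar A = 0 ∨ quotientHaar A = 1) ∧
      quotientHaar Set.univ = 1 ∧
      (∀ a : Quotient E0, quotientHaar {a} = 0)) ∧
    -- the induced `S₂`-action on `(2^ω, E₀)` is Borel, free and measure preserving, and its orbit
    -- equivalence relation is `E₀(S₂)/E₀`
    (IsBorelAction E0 S2 ∧
      (∀ (σ : S2) (a : Quotient E0), σ • a = a → σ = 1) ∧
      (∀ σ : S2, MeasurePreserving (fun a : Quotient E0 => σ • a) quotientHaar quotientHaar) ∧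
      MulAction.orbitRel S2 (Quotient E0) = quotientRel E0 E0S2 E0_le_E0S2) ∧
    -- `E₀(S₂)/E₀` is a nonsmooth countable Borel equivalence relation of index 2
    (IsCountableBorelOver (quotientRel E0 E0S2 E0_le_E0S2) ∧
      HasIndex (quotientRel E0 E0S2 E0_le_E0S2) 2 ∧
      ¬ IsSmoothOver (quotientRel E0 E0S2 E0_le_E0S2)) ∧
    -- `E` and `F` are countable Borel equivalence relations on the standard Borel space `2^ω × 2`,
    -- and `F/E` is a countable Borel equivalence relation of index 3 on `(2^ω × 2, E)`
    (IsQuotientBorelSpace (Cantor × Fin 2) relE ∧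
      IsQuotientBorelSpace (Cantor × Fin 2) relF ∧
      IsCountableBorelOver (quotientRel relE relF relE_le_relF) ∧
      HasIndex (quotientRel relE relF relE_le_relF) 3) ∧
    -- `F/E` is smooth: `(2^ω × {0})/E` is a Borel transversal, and `(x, i) ↦ (x, 0)` induces a
    -- Borel selector
    (IsSmoothOver (quotientRel relE relF relE_le_relF) ∧
      IsBorelTransversal (quotientRel relE relF relE_le_relF)
        (Quotient.mk relE '' {p | p.2 = 0}) ∧
      IsBorelSelector (quotientRel relE relF relE_le_relF) selectorMap) ∧
    -- `F/E` is generated by this single Borel map, which is 3-to-1 onto its range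
    (IsGeneratedBy (quotientRel relE relF relE_le_relF) selectorMap ∧
      ∀ a, {b | selectorMap b = selectorMap a}.encard = 3) ∧
    -- `F/E` is not Borel enumerable
    ¬ IsEnumerable (quotientRel relE relF relE_le_relF) := by
  exact ⟨⟨isQuotientBorelSpace_E0, not_isSmooth_of_isZeroOneMeasure quotientHaar,
      fun A _ => quotientHaar.zero_one A, measure_univ, measure_singleton⟩,
    ⟨isInducedAction_S2_E0.isBorelAction measurableSet_E0, eq_one_of_smul_eq,
      fun σ => measurePreserving_smul σ quotientHaar, orbitRel_S2_eq_quotientRel⟩,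
    ⟨isQuotientBorelSpace_E0S2.isCountableBorelOver E0_le_E0S2, hasIndex_quotientRel_E0S2,
      not_isSmoothOver_E0S2⟩,
    ⟨isQuotientBorelSpace_relE, isQuotientBorelSpace_relF,
      isQuotientBorelSpace_relF.isCountableBorelOver relE_le_relF, hasIndex_quotientRel_relF⟩,
    ⟨⟨_, isBorelTransversal_zero⟩, isBorelTransversal_zero, isBorelSelector_selectorMap⟩,
    ⟨isBorelSelector_selectorMap.isGeneratedBy,
      isBorelSelector_selectorMap.encard_fibre hasIndex_quotientRel_relF⟩,
    not_isEnumerable_quotientRel_relF⟩
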